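/- Let $\sigma$ be a relational signature, $\sigma_{\le 2}$ and $\sigma_{>2}$ its relations of arity at most two and of arity greater than two. The shredded signature $\sigma_S$ consists of $\sigma_{\le 2}$, a unary relation $\mathrm{Elt}$ and, for each $R\in\sigma_{>2}$ of arity $n$, a unary relation $A_R$ and binary relations $R_1,\dots,R_n$. The shredding $\mathrm{SHR}$ of a conjunction of atoms keeps the atoms of $\sigma_{\le 2}$ and replaces each atom $R(x_1,\dots,x_n)$ with $R\in\sigma_{>2}$ by $A_R(t)\wedge\bigwedge_i R_i(t,x_i)$ with $t$ a fresh variable; an existential rule is shredded by shredding its body and its head. A $\sigma_S$-interpretation $\mathcal J$ is well-formed if its domain is partitioned by $\mathrm{Elt}^{\mathcal J}$ and the $A_R^{\mathcal J}$, all tuples of relations of $\sigma_{\le 2}$ consist of elements of $\mathrm{Elt}^{\mathcal J}$, $R_i^{\mathcal J}\subseteq A_R^{\mathcal J}\times\mathrm{Elt}^{\mathcal J}$, and each $t\in A_R^{\mathcal J}$ has exactly one $a$ with $(t,a)\in R_i^{\mathcal J}$, for each $i$. The unshredding of $\mathcal J$ is the $\sigma$-interpretation with domain $\mathrm{Elt}^{\mathcal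 J}$ that keeps the relations of $\sigma_{\le2}$ and where, for $R\in\sigma_{>2}$, $R$ consists of the tuples $\mathbf a$ such that for some $t\in A_R^{\mathcal J}$ we have $(t,a_i)\in R_i^{\mathcal J}$ for all $i$. Let $\Phi$ be a set of functional dependencies $R^P\to R^r$ with $R\in\sigma_{>2}$ and nonempty determiner $P$. A rule with a single head atom is non-conflicting with $\Phi$ if, for each dependency of $\Phi$ on the relation of the head atom, with determiner $P$, the set $Q$ of positions of the head atom that carry frontier variables (variables shared by body and head) is not a strict superset of $P$, and if $Q=P$ then each existential variable occurs only once in the head atom. A rule is frontier-one if it has exactly one frontier variable. A witness of a $\sigma_S$-fact $F$ (a finite conjunction of atoms) in $\mathcal J$ is the interpretation $\mathcal W$ induced by $\mathcal J$ on the image of the variables of $F$ under a match of $F$ in $\mathcal J$; $\mathrm{dom}(\mathcal W)$ is this image. $\mathcal J$ is cycle-free except for $\mathcal W$ if every cycle of the Gaifman graph of $\mathcal J$ consists only of elements of $\mathrm{dom}(\mathcal W)$. $\mathcal J$ is FD-safe except for $\mathcal W$ if, for each determiner $P$ of a dependency of $\Phi$ on $R$, whenever $t\ne t'$ and $a$ are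 such that $(t,a),(t',a)\in R_i^{\mathcal J}$ for all $i\in P$, both $t$ and $t'$ are in $\mathrm{dom}(\mathcal W)$. Lemma. Let $\Sigma$ be a set of $\mathrm{GC}^2$ sentences (guarded two-variable logic with equality and counting quantifiers, where counting is guarded by atoms containing both variables) over $\sigma_{\le2}$, $\Delta$ a set of single-head frontier-one existential rules over $\sigma$ that are non-conflicting with $\Phi$, $F$ a $\sigma_S$-fact, and $q$ a Boolean conjunctive query over $\sigma_S$. Let $\mathcal J$ be a well-formed $\sigma_S$-interpretation (with nonempty domain) that satisfies $\Sigma$, $\mathrm{SHR}(\Delta)$ and $\neg q$, and has a witness $\mathcal W$ of $F$ whose unshredding satisfies $\Phi$. Then there is a well-formed $\sigma_S$-interpretation $T$ with nonempty domain that satisfies $\Sigma$, $\mathrm{SHR}(\Delta)$ and $\neg q$, and has a witness $\mathcal W'$ of $F$ whose unshredding satisfies $\Phi$, such that $T$ is cycle-free and FD-safe except for $\mathcal W'$. Moreover there is a homomorphism from $T$ to $\mathcal J$ that restricts to an isomorphism from $\mathcal W'$ onto $\mathcal W$ and maps the match of $F$ that gives $\mathcal W'$ to the one that gives $\mathcal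 W$. -/

import Mathlib

universe u v w

/-! Relational signatures, interpretations, conjunctions of atoms, existential rules -/

/-- A relational signature: relation names with their arities. -/
structure Signature where
  Rel : Type v
  arity : Rel → ℕ

/-- An atom `R(x₁, …, xₙ)` over the variables `V`. -/
structure Atom (σ : Signature.{v}) (V : Type w) where
  rel : σ.Rel
  args : Fin (σ.arity rel) → V

/-- A finite conjunction of atoms. Facts and Boolean conjunctive queries are such conjunctions,
read under existential quantification of all their variables. -/
abbrev Conj (σ : Signature.{v}) (V : Type w) := List (Atom σ V)

/-- The variables that occur in a conjunction of atoms. -/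
def Conj.vars {σ : Signature.{v}} {V : Type w} (Ψ : Conj σ V) : Set V :=
  {x | ∃ A ∈ Ψ, ∃ i, A.args i = x}

/-- An interpretation of the signature `σ` with domain `D`. -/
structure Interp (σ : Signature.{v}) (D : Type u) where
  rel : (R : σ.Rel) → (Fin (σ.arity R) → D) → Prop

/-- The assignment `f` is a match of the conjunction `Ψ` in `J`. -/
def Interp.IsMatch {σ : Signature.{v}} {D : Type u} {V : Type w} (J : Interp σ D)
    (f : V → D) (Ψ : Conj σ V) : Prop :=
  ∀ A ∈ Ψ, J.rel A.rel (fun i => f (A.args i))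

/-- `J` satisfies the Boolean conjunctive query `q` (equally, the existential closure of the
fact `q`). -/
def Interp.SatCQ {σ : Signature.{v}} {D : Type u} {V : Type w} (J : Interp σ D)
    (q : Conj σ V) : Prop :=
  ∃ f : V → D, J.IsMatch f q

/-- The interpretation induced by a subset of the domain. -/
def Interp.induce {σ : Signature.{v}} {D : Type u} (J : Interp σ D) (S : Set D) : Interp σ S :=
  ⟨fun R a => J.rel R (fun i => (a i : D))⟩

/-- Homomorphisms of interpretations. -/
def Interp.IsHom {σ : Signature.{v}} {D E : Type u} (T : Interp σ E) (J : Interp σ D)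
    (p : E → D) : Prop :=
  ∀ R a, T.rel R a → J.rel R (fun i => p (a i))

/-- The Gaifman graph: two distinct elements are adjacent when they co-occur in a tuple. -/
def Interp.gaifman {σ : Signature.{v}} {D : Type u} (J : Interp σ D) : SimpleGraph D where
  Adj a b := a ≠ b ∧ ∃ R c, J.rel R c ∧ (∃ i, c i = a) ∧ ∃ j, c j = b
  symm := ⟨fun _ _ h => ⟨h.1.symm, by
    obtain ⟨_, R, c, hc, hi, hj⟩ := h
    exact ⟨R, c, hc, hj, hi⟩⟩⟩
  loopless := ⟨fun _ h => h.1 rfl⟩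

/-- Every cycle of the Gaifman graph consists only of elements of `S`. -/
def Interp.CycleFreeExcept {σ : Signature.{v}} {D : Type u} (J : Interp σ D) (S : Set D) : Prop :=
  ∀ (a : D) (c : J.gaifman.Walk a a), c.IsCycle → ∀ b ∈ c.support, b ∈ S

/-- The existential rule `∀ x (body(x) → ∃ y head(x', y))`: the variables of the head that do not
occur in the body are existentially quantified. -/
structure Rule (σ : Signature.{v}) (V : Type w) where
  body : Conj σ V
  head : Conj σ V

/-- The frontier: the variables shared by the body and the head. -/
def Rule.frontier {σ : Signature.{v}} {V : Type w} (τ : Rule σ V) : Set V :=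
  τ.body.vars ∩ τ.head.vars

/-- Frontier-one rules. -/
def Rule.FrontierOne {σ : Signature.{v}} {V : Type w} (τ : Rule σ V) : Prop :=
  ∃ x, τ.frontier = {x}

/-- `J` satisfies the rule `τ`. -/
def Interp.SatRule {σ : Signature.{v}} {D : Type u} {V : Type w} (J : Interp σ D)
    (τ : Rule σ V) : Prop :=
  ∀ f : V → D, J.IsMatch f τ.body →
    ∃ g : V → D, (∀ x ∈ τ.body.vars, g x = f x) ∧ J.IsMatch g τ.head

/-! Functional dependencies on higher-arity relations -/

/-- A functional dependency `R^P → R^r` on a relation of arity greater than two, with nonempty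
determiner `P`. -/
structure FD (σ : Signature.{v}) where
  rel : σ.Rel
  higher : 2 < σ.arity rel
  det : Set (Fin (σ.arity rel))
  det_nonempty : det.Nonempty
  res : Fin (σ.arity rel)

/-- `I` satisfies the functional dependency `φ`. -/
def Interp.SatFD {σ : Signature.{v}} {D : Type u} (I : Interp σ D) (φ : FD σ) : Prop :=
  ∀ a b, I.rel φ.rel a → I.rel φ.rel b → (∀ i ∈ φ.det, a i = b i) → a φ.res = b φ.res

/-- A single-head rule is non-conflicting with the dependencies `Φ` when, for each dependency on
the relation of the head atom, the set of the head positions that carry frontier variables is not a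
strict superset of the determiner and, if it is exactly the determiner, then each existential
variable occurs only once in the head atom. -/
def Rule.NonConflicting {σ : Signature.{v}} {V : Type w} (τ : Rule σ V) (Φ : Set (FD σ)) : Prop :=
  (∃ A, τ.head = [A]) ∧
  ∀ φ ∈ Φ, ∀ z : Fin (σ.arity φ.rel) → V, τ.head = [⟨φ.rel, z⟩] →
    ¬ φ.det ⊂ {i | z i ∈ τ.frontier} ∧
    (φ.det = {i | z i ∈ τ.frontier} → ∀ i j, z i ∉ τ.frontier → z i = z j → i = j)

/-! The guarded two-variable fragment with counting quantifiers -/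

/-- The part of the signature that consists of the relations of arity at most two. -/
def Signature.low (σ : Signature.{v}) : Signature.{v} where
  Rel := {R : σ.Rel // σ.arity R ≤ 2}
  arity R := σ.arity R.1

/-- Two-variable formulas with equality and counting quantifiers `∃^{≥n}`; the two variables are
`0` and `1`. The other connectives and quantifiers are the usual abbreviations. -/
inductive C2 (σ : Signature.{v}) : Type v
  | eq (x y : Fin 2) : C2 σ
  | rel (R : σ.Rel) (args : Fin (σ.arity R) → Fin 2) : C2 σ
  | neg (φ : C2 σ) : C2 σ
  | and (φ ψ : C2 σ) : C2 σ
  | exGe (n : ℕ) (x : Fin 2) (φ : C2 σ) : C2 σ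

/-- Free variables. -/
def C2.free {σ : Signature.{v}} : C2 σ → Set (Fin 2)
  | .eq x y => {x, y}
  | .rel _ args => Set.range args
  | .neg φ => φ.free
  | .and φ ψ => φ.free ∪ ψ.free
  | .exGe _ x φ => φ.free \ {x}

/-- Satisfaction of a formula in `J` under an assignment of the two variables. -/
def C2.Sat {σ : Signature.{v}} {D : Type u} (J : Interp σ D) : C2 σ → (Fin 2 → D) → Prop
  | .eq x y, f => f x = f y
  | .rel R args, f => J.rel R (fun i => f (args i))
  | .neg φ, f => ¬ φ.Sat J f
  | .and φ ψ, f => φ.Sat J f ∧ ψ.Sat J f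
  | .exGe n x φ, f => (n : ℕ∞) ≤ {d : D | φ.Sat J (Function.update f x d)}.encard

/-- Atomic formulas that contain both variables: these can serve as guards. -/
def C2.IsGuard {σ : Signature.{v}} : C2 σ → Prop
  | .eq x y => x ≠ y
  | .rel _ args => Function.Surjective args
  | _ => False

/-- The fragment GC²: closed under Boolean connectives, under plain quantification of formulas
with at most one free variable, and under counting quantification guarded by an atom that contains
both variables. -/
inductive C2.IsGC2 {σ : Signature.{v}} : C2 σ → Prop
  | eq (x y : Fin 2) : C2.IsGC2 (.eq x y)
  | rel (R : σ.Rel) (args : Fin (σ.arity R) → Fin 2) : C2.IsGC2 (.rel R args)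
  | neg {φ : C2 σ} : C2.IsGC2 φ → C2.IsGC2 (.neg φ)
  | and {φ ψ : C2 σ} : C2.IsGC2 φ → C2.IsGC2 ψ → C2.IsGC2 (.and φ ψ)
  | ex (x : Fin 2) {φ : C2 σ} : C2.IsGC2 φ → φ.free ⊆ {x} → C2.IsGC2 (.exGe 1 x φ)
  | guarded (n : ℕ) (x : Fin 2) {γ φ : C2 σ} :
      γ.IsGuard → C2.IsGC2 φ → C2.IsGC2 (.exGe n x (.and γ φ))

/-- A GC² constraint: a GC² formula without free variables. -/
def C2.IsConstraint {σ : Signature.{v}} (φ : C2 σ) : Prop :=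
  φ.IsGC2 ∧ φ.free = ∅

/-- `J` satisfies the sentence `φ`. -/
def Interp.SatC2 {σ : Signature.{v}} {D : Type u} (J : Interp σ D) (φ : C2 σ) : Prop :=
  ∀ f : Fin 2 → D, φ.Sat J f

/-! Shredding -/

/-- The relation names of the shredded signature: the relations of arity at most two, the unary
relation `Elt` and, for each higher-arity relation `R`, a unary relation `A_R` and one binary
relation `R_i` for each position of `R`. -/
inductive ShredRel (σ : Signature.{v}) : Type v
  | base (R : σ.Rel) (h : σ.arity R ≤ 2) : ShredRel σ
  | elt : ShredRel σ
  | tup (R : σ.Rel) (h : 2 < σ.arity R) : ShredRel σ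
  | proj (R : σ.Rel) (h : 2 < σ.arity R) (i : Fin (σ.arity R)) : ShredRel σ

/-- Arities in the shredded signature. -/
def ShredRel.ar {σ : Signature.{v}} : ShredRel σ → ℕ
  | .base R _ => σ.arity R
  | .elt => 1
  | .tup _ _ => 1
  | .proj _ _ _ => 2

/-- The shredded signature. -/
def Signature.shred (σ : Signature.{v}) : Signature.{v} where
  Rel := ShredRel σ
  arity := ShredRel.ar

namespace Interp

variable {σ : Signature.{v}} {D : Type u} (J : Interp σ.shred D)

/-- The tuples of a relation of arity at most two. -/
def base (R : σ.Rel) (h : σ.arity R ≤ 2) (a : Fin (σ.arity R) → D) : Prop :=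
  J.rel (ShredRel.base R h) a

/-- The unary relation `Elt`. -/
def elt (a : D) : Prop := J.rel ShredRel.elt (fun _ => a)

/-- The unary relation `A_R`. -/
def tup (R : σ.Rel) (h : 2 < σ.arity R) (t : D) : Prop :=
  J.rel (ShredRel.tup R h) (fun _ => t)

/-- The binary relation `R_i`. -/
def proj (R : σ.Rel) (h : 2 < σ.arity R) (i : Fin (σ.arity R)) (t a : D) : Prop :=
  J.rel (ShredRel.proj R h i) (![t, a] : Fin 2 → D)

/-- The reduct to the relations of arity at most two of the original signature. -/
def low : Interp σ.low D := ⟨fun R a => J.base R.1 R.2 a⟩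

/-- Well-formedness of an interpretation of the shredded signature. -/
structure WellFormed : Prop where
  cover : ∀ a, J.elt a ∨ ∃ R h, J.tup R h a
  elt_not_tup : ∀ a R h, J.elt a → ¬ J.tup R h a
  tup_disjoint : ∀ a R h R' h', J.tup R h a → J.tup R' h' a → R = R'
  base_elt : ∀ R h a, J.base R h a → ∀ i, J.elt (a i)
  proj_typed : ∀ R h i t a, J.proj R h i t a → J.tup R h t ∧ J.elt a
  proj_unique : ∀ R h i t, J.tup R h t → ∃! a, J.proj R h i t a

/-- The unshredding: its domain is `Elt`, the relations of arity at most two are kept, and each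
element `t` of `A_R` gives the tuples `a` such that `R_i(t, aᵢ)` for all `i`. -/
def unshred : Interp σ {a : D // J.elt a} :=
  ⟨fun R a => (∃ h : σ.arity R ≤ 2, J.base R h (fun i => (a i).1)) ∨
    ∃ h : 2 < σ.arity R, ∃ t, J.tup R h t ∧ ∀ i, J.proj R h i t (a i).1⟩

/-- For each determiner `P` of a dependency of `Φ` on `R`, any two distinct elements `t`, `t'` that
are related to a common element by all `R_i` with `i ∈ P` both belong to `S`. -/
def FDSafeExcept (Φ : Set (FD σ)) (S : Set D) : Prop :=
  ∀ φ ∈ Φ, ∀ t t' a : D, t ≠ t' →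
    (∀ i ∈ φ.det, J.proj φ.rel φ.higher i t a) →
    (∀ i ∈ φ.det, J.proj φ.rel φ.higher i t' a) → t ∈ S ∧ t' ∈ S

end Interp

/-- The shredding of one atom: atoms of arity at most two are kept, and `R(x₁, …, xₙ)` of higher
arity becomes `A_R(t) ∧ R_1(t, x₁) ∧ … ∧ R_n(t, xₙ)`. The fresh variable `t` is named by the atom
and by the mark `b`, which tells apart the body and the head of a rule. -/
def Atom.shred {σ : Signature.{v}} {V : Type w} (b : Bool) (A : Atom σ V) :
    Conj σ.shred (V ⊕ Bool × Atom σ V) :=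
  if h : σ.arity A.rel ≤ 2 then
    [⟨ShredRel.base A.rel h, fun i => Sum.inl (A.args i)⟩]
  else
    ⟨ShredRel.tup A.rel (not_le.mp h), fun _ => Sum.inr (b, A)⟩ ::
      List.ofFn (fun i : Fin (σ.arity A.rel) =>
        (⟨ShredRel.proj A.rel (not_le.mp h) i,
          (![Sum.inr (b, A), Sum.inl (A.args i)] : Fin 2 → V ⊕ Bool × Atom σ V)⟩ :
          Atom σ.shred (V ⊕ Bool × Atom σ V)))

/-- The shredding of a conjunction of atoms. -/
def Conj.shred {σ : Signature.{v}} {V : Type w} (b : Bool) (Ψ : Conj σ V) :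
    Conj σ.shred (V ⊕ Bool × Atom σ V) :=
  Ψ.flatMap (Atom.shred b)

/-- The shredding of a rule: the body and the head are shredded, with distinct fresh variables. -/
def Rule.shred {σ : Signature.{v}} {V : Type w} (τ : Rule σ V) :
    Rule σ.shred (V ⊕ Bool × Atom σ V) :=
  ⟨Conj.shred false τ.body, Conj.shred true τ.head⟩

/-! `T` is a tree-like unraveling of `J` around the set `S` of elements of the witness. Each element
of `D` has a root copy, the roots in `S` are related as in `J`, and all other relations hold only
within a node or between parent and child. Hence cycles stay in the core, and the map `val` to `J`
is a homomorphism, which gives `¬ q` and lets rule bodies be matched in `J`.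

For `GC²`, every neighbour of an element in the low-arity relations must have exactly one copy next
to each copy of that element (`exists_link`, `link_unique`). A child is therefore created only for a
neighbour that is not yet present as the node itself, in the core or as the parent. Guarded counting
then gives the same numbers in `T` and `J`.

Tuples need the opposite care. An element node gets a child copy of a tuple for each set `Q` of
positions that carry its element and contain no determiner. If `Q` is a minimal determiner, it gets
one chosen tuple at most, and none when its parent or a core tuple already has the node at all of
`Q`. This yields FD-safety. It also suffices for the rules: by non-conflictingness the frontier
positions of a head either contain no determiner, so the tuple in `J` can be copied, or form a
minimal determiner, and then the existential variables are pairwise distinct, so that any tuple with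
the frontier element at these positions is a match. -/

/-- Nodes of the unraveling: a root for each element of `D`, and children that carry an element of
`D` and, when that element is a tuple, the set of the positions at which it is attached to its
parent. -/
inductive UnravelNode (D : Type u) : Type u
  | root (d : D) : UnravelNode D
  | child (n : UnravelNode D) (Q : Set ℕ) (d : D) : UnravelNode D

namespace UnravelNode

variable {D : Type u}

/-- The element of which a node is a copy. -/
def val : UnravelNode D → D
  | root d => d
  | child _ _ d => d

/-- The distance to the root. -/
def depth : UnravelNode D → ℕ
  | root _ => 0
  | child n _ _ => n.depth + 1

/-- The node `m` is a child of `n`. -/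
def IsChild (m n : UnravelNode D) : Prop := ∃ Q d, m = child n Q d

/-- Both nodes are roots that carry elements of `S`. -/
def RootPair (S : Set D) (m n : UnravelNode D) : Prop :=
  ∃ a ∈ S, ∃ b ∈ S, m = root a ∧ n = root b

/-- The nodes are equal, or both in the core `S`, or parent and child. -/
def Link (S : Set D) (m n : UnravelNode D) : Prop :=
  m = n ∨ RootPair S m n ∨ IsChild m n ∨ IsChild n m

theorem IsChild.depth_eq {m n : UnravelNode D} (h : IsChild m n) : m.depth = n.depth + 1 := by
  obtain ⟨Q, d, rfl⟩ := h
  rfl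

theorem IsChild.parent_unique {l m n : UnravelNode D} (h : IsChild l m) (h' : IsChild l n) :
    m = n := by
  obtain ⟨Q, d, rfl⟩ := h
  obtain ⟨Q', d', h'⟩ := h'
  injection h'

theorem RootPair.symm {S : Set D} {m n : UnravelNode D} (h : RootPair S m n) :
    RootPair S n m := by
  obtain ⟨a, ha, b, hb, rfl, rfl⟩ := h
  exact ⟨b, hb, a, ha, rfl, rfl⟩

theorem Link.symm {S : Set D} {m n : UnravelNode D} (h : Link S m n) : Link S n m := by
  rcases h with h | h | h | h
  · exact .inl h.symm
  · exact .inr (.inl h.symm)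
  · exact .inr (.inr (.inr h))
  · exact .inr (.inr (.inl h))

theorem RootPair.not_isChild_left {S : Set D} {l m n : UnravelNode D} (h : RootPair S m n) :
    ¬ IsChild m l := by
  obtain ⟨a, _, b, _, rfl, rfl⟩ := h
  rintro ⟨Q, d, h⟩
  cases h

end UnravelNode

open UnravelNode

/-! ### The unraveling of `J` around `S` -/

namespace Interp

variable {σ : Signature.{v}} {D : Type u} (J : Interp σ.shred D) (S : Set D) (Φ : Set (FD σ))

/-- The tuple `t` has the value `a` at the position with index `k`. -/
def posVal (k : ℕ) (t a : D) : Prop :=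
  ∃ R h, ∃ i : Fin (σ.arity R), (i : ℕ) = k ∧ J.proj R h i t a

/-- Two elements co-occur in a tuple of a relation of arity at most two. -/
def baseAdj (a b : D) : Prop :=
  ∃ R h c, J.base R h c ∧ (∃ i, c i = a) ∧ ∃ j, c j = b

/-- The positions at which a tuple node is attached to nodes other than its children. -/
def attached : UnravelNode D → Set ℕ
  | root t => {k | t ∈ S ∧ ∃ a ∈ S, J.posVal k t a}
  | child _ Q _ => Q

/-- The node `a` is at the position `k` of the tuple node `t`, provided that the elements that they
carry have this relationship. -/
def conn (k : ℕ) (t a : UnravelNode D) : Prop :=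
  (IsChild a t ∧ k ∉ J.attached S t) ∨ (k ∈ J.attached S t ∧ (RootPair S t a ∨ IsChild t a))

/-- The node `n` already occurs at all positions in `Q` of some `R`-tuple other than its
children. -/
def blocked (n : UnravelNode D) (R : σ.Rel) (Q : Set ℕ) : Prop :=
  ∃ t, (RootPair S t n ∨ IsChild n t) ∧ (∃ h, J.tup R h t.val) ∧
    ∀ k ∈ Q, J.posVal k t.val n.val ∧ J.conn S k t n

/-- The position set `Q` contains no determiner of a dependency on the relation of the
tuple `d`. -/
def detFree (Q : Set ℕ) (d : D) : Prop :=
  ∀ φ ∈ Φ, J.tup φ.rel φ.higher d → ¬ Fin.val '' φ.det ⊆ Q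

/-- A choice of an `R`-tuple in which `a` occurs at all positions in `Q`. -/
noncomputable def pick (R : σ.Rel) (Q : Set ℕ) (a : D) : D :=
  @Classical.epsilon D ⟨a⟩ (fun t => (∃ h, J.tup R h t) ∧ ∀ k ∈ Q, J.posVal k t a)

/-- The position set `Q` is a minimal determiner of a dependency on the relation of the tuple `d`,
the node `n` does not yet occur at these positions, and `d` is the chosen tuple. -/
def detMinimal (n : UnravelNode D) (Q : Set ℕ) (d : D) : Prop :=
  ∃ φ ∈ Φ, Q = Fin.val '' φ.det ∧ J.tup φ.rel φ.higher d ∧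
    (∀ ψ ∈ Φ, J.tup ψ.rel ψ.higher d → ¬ Fin.val '' ψ.det ⊂ Q) ∧
    d = J.pick φ.rel Q n.val ∧ ¬ J.blocked S n φ.rel Q

/-- The conditions under which the node `n` has the child `child n Q d`: a neighbour in a relation
of arity at most two, the value of a tuple, or a tuple. -/
def step (n : UnravelNode D) (Q : Set ℕ) (d : D) : Prop :=
  (Q = ∅ ∧ J.baseAdj n.val d ∧ d ≠ n.val ∧ ¬ RootPair S n (root d) ∧
    ¬ ∃ m, IsChild n m ∧ J.elt m.val ∧ m.val = d) ∨
  (Q = ∅ ∧ ∃ k ∉ J.attached S n, J.posVal k n.val d) ∨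
  (J.elt n.val ∧ (∃ R h, J.tup R h d) ∧ (∀ k ∈ Q, J.posVal k d n.val) ∧
    (J.detFree Φ Q d ∨ J.detMinimal S Φ n Q d))

/-- The nodes that belong to the unraveling. -/
def validNode : UnravelNode D → Prop
  | root _ => True
  | child n Q d => validNode n ∧ J.step S Φ n Q d

/-- The domain of the unraveling. -/
abbrev UnravelDom : Type u := {n : UnravelNode D // J.validNode S Φ n}

/-- The unraveling of `J` around `S`. -/
def unravel : Interp σ.shred (J.UnravelDom S Φ) where
  rel R := match R with
    | .base R h => fun a =>
      J.base R h (fun i => (a i).1.val) ∧ ∀ i j, Link S (a i).1 (a j).1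
    | .elt => fun a => J.elt (a (0 : Fin 1)).1.val
    | .tup R h => fun a => J.tup R h (a (0 : Fin 1)).1.val
    | .proj R h i => fun a =>
      J.proj R h i (a (0 : Fin 2)).1.val (a (1 : Fin 2)).1.val ∧
        J.conn S i (a (0 : Fin 2)).1 (a (1 : Fin 2)).1

variable {J S Φ}

theorem unravel_base {R : σ.Rel} {h : σ.arity R ≤ 2} {a : Fin (σ.arity R) → J.UnravelDom S Φ} :
    (J.unravel S Φ).base R h a ↔
      J.base R h (fun i => (a i).1.val) ∧ ∀ i j, Link S (a i).1 (a j).1 :=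
  Iff.rfl

theorem unravel_tup {R : σ.Rel} {h : 2 < σ.arity R} {t : J.UnravelDom S Φ} :
    (J.unravel S Φ).tup R h t ↔ J.tup R h t.1.val :=
  Iff.rfl

theorem unravel_proj {R : σ.Rel} {h : 2 < σ.arity R} {i : Fin (σ.arity R)}
    {t a : J.UnravelDom S Φ} :
    (J.unravel S Φ).proj R h i t a ↔ J.proj R h i t.1.val a.1.val ∧ J.conn S i t.1 a.1 :=
  Iff.rfl

theorem rel_proj_iff {E : Type u} (T : Interp σ.shred E) {R : σ.Rel} {h : 2 < σ.arity R}
    {i : Fin (σ.arity R)} {c : Fin 2 → E} :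
    T.rel (ShredRel.proj R h i) c ↔ T.proj R h i (c 0) (c 1) := by
  have : c = ![c 0, c 1] := by
    funext j
    fin_cases j <;> rfl
  conv_lhs => rw [this]
  rfl

theorem rel_elt_iff {E : Type u} (T : Interp σ.shred E) {c : Fin 1 → E} :
    T.rel ShredRel.elt c ↔ T.elt (c 0) := by
  have : c = fun _ => c 0 := by
    funext j
    fin_cases j
    rfl
  conv_lhs => rw [this]
  rfl

theorem rel_tup_iff {E : Type u} (T : Interp σ.shred E) {R : σ.Rel} {h : 2 < σ.arity R}
    {c : Fin 1 → E} : T.rel (ShredRel.tup R h) c ↔ T.tup R h (c 0) := by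
  have : c = fun _ => c 0 := by
    funext j
    fin_cases j
    rfl
  conv_lhs => rw [this]
  rfl

theorem unravel_isHom : (J.unravel S Φ).IsHom J (fun n => n.1.val) := by
  intro R a h
  cases R with
  | base R hR => exact h.1
  | elt => exact (rel_elt_iff J).2 h
  | tup R hR => exact (rel_tup_iff J).2 h
  | proj R hR i => exact (rel_proj_iff J).2 h.1

/-! ### Well-formedness and unique lifting of neighbours -/

section WellFormed

variable (wf : J.WellFormed)
include wf

/-- The sets of tuples are disjoint, so `t` determines its relation. This is why positions can be
recorded in nodes as natural numbers, without naming the relation. -/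
theorem WellFormed.posVal_iff {R : σ.Rel} {h : 2 < σ.arity R} {t a : D} (ht : J.tup R h t)
    (i : Fin (σ.arity R)) : J.posVal i t a ↔ J.proj R h i t a := by
  refine ⟨?_, fun hp => ⟨R, h, i, rfl, hp⟩⟩
  rintro ⟨R', h', i', hi, hp⟩
  obtain rfl := wf.tup_disjoint _ _ _ _ _ ht (wf.proj_typed _ _ _ _ _ hp).1
  obtain rfl := Fin.ext hi
  exact hp

theorem WellFormed.posVal_typed {k : ℕ} {t a : D} (h : J.posVal k t a) :
    (∃ R h, J.tup R h t) ∧ J.elt a := by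
  obtain ⟨R, h, i, -, hp⟩ := h
  exact ⟨⟨R, h, (wf.proj_typed _ _ _ _ _ hp).1⟩, (wf.proj_typed _ _ _ _ _ hp).2⟩

theorem WellFormed.posVal_unique {k : ℕ} {t a b : D} (h : J.posVal k t a) (h' : J.posVal k t b) :
    a = b := by
  obtain ⟨R, h, i, rfl, hp⟩ := h
  have ht := (wf.proj_typed _ _ _ _ _ hp).1
  exact (wf.proj_unique R h i t ht).unique hp ((wf.posVal_iff ht i).1 h')

theorem WellFormed.baseAdj_elt {a b : D} (h : J.baseAdj a b) : J.elt a ∧ J.elt b := by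
  obtain ⟨R, h, c, hc, ⟨i, rfl⟩, j, rfl⟩ := h
  exact ⟨wf.base_elt _ _ _ hc i, wf.base_elt _ _ _ hc j⟩

/-- The first kind of step excludes the value of `n` explicitly; the other two pass between tuples
and elements of `Elt`, which are disjoint. -/
theorem WellFormed.step_ne {n : UnravelNode D} {Q : Set ℕ} {d : D} (h : J.step S Φ n Q d) :
    d ≠ n.val := by
  rintro rfl
  rcases h with h | ⟨-, k, -, h⟩ | ⟨h, ⟨R, hR, h'⟩, -⟩
  · exact h.2.2.1 rfl
  · obtain ⟨⟨R, h, ht⟩, he⟩ := wf.posVal_typed h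
    exact wf.elt_not_tup _ _ _ he ht
  · exact wf.elt_not_tup _ _ _ h h'

theorem WellFormed.step_elt_elt {n : UnravelNode D} {Q : Set ℕ} {d : D} (h : J.step S Φ n Q d)
    (hn : J.elt n.val) (hd : J.elt d) :
    Q = ∅ ∧ ¬ RootPair S n (root d) ∧ ¬ ∃ m, IsChild n m ∧ J.elt m.val ∧ m.val = d := by
  rcases h with h | ⟨-, k, -, h⟩ | ⟨-, ⟨R, hR, h'⟩, -⟩
  · exact ⟨h.1, h.2.2.2⟩
  · obtain ⟨⟨R, h, ht⟩, -⟩ := wf.posVal_typed h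
    exact absurd ht (wf.elt_not_tup _ _ _ hn)
  · exact absurd h' (wf.elt_not_tup _ _ _ hd)

theorem WellFormed.step_tup {n : UnravelNode D} {Q : Set ℕ} {d : D} (h : J.step S Φ n Q d)
    {R : σ.Rel} {hR : 2 < σ.arity R} (hd : J.tup R hR d) :
    (∀ k ∈ Q, J.posVal k d n.val) ∧ (J.detFree Φ Q d ∨ J.detMinimal S Φ n Q d) := by
  rcases h with h | ⟨-, k, -, h⟩ | h
  · exact absurd hd (wf.elt_not_tup _ _ _ (wf.baseAdj_elt h.2.1).2)
  · exact absurd hd (wf.elt_not_tup _ _ _ (wf.posVal_typed h).2)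
  · exact h.2.2

theorem WellFormed.step_of_tup {n : UnravelNode D} {Q : Set ℕ} {d : D} (h : J.step S Φ n Q d)
    {R : σ.Rel} {hR : 2 < σ.arity R} (hn : J.tup R hR n.val) : Q = ∅ := by
  rcases h with h | h | h
  · exact h.1
  · exact h.1
  · exact absurd hn (wf.elt_not_tup _ _ _ h.1)

theorem WellFormed.eq_of_link {m n : UnravelNode D} (hm : J.validNode S Φ m)
    (hn : J.validNode S Φ n) (h : Link S m n) (hv : m.val = n.val) : m = n := by
  rcases h with h | ⟨a, -, b, -, rfl, rfl⟩ | ⟨Q, d, rfl⟩ | ⟨Q, d, rfl⟩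
  · exact h
  · exact congrArg root hv
  · exact absurd hv (wf.step_ne hm.2)
  · exact absurd hv.symm (wf.step_ne hn.2)

/-- Neighbours of elements in the relations of arity at most two lift uniquely. -/
theorem WellFormed.link_unique {l m n : UnravelNode D} (hl : J.validNode S Φ l)
    (hm : J.validNode S Φ m) (hn : J.validNode S Φ n) (el : J.elt l.val) (em : J.elt m.val)
    (h : Link S l m) (h' : Link S l n) (hv : m.val = n.val) : m = n := by
  have en : J.elt n.val := hv ▸ em
  rcases h with rfl | h
  · exact wf.eq_of_link hl hn h' hv
  rcases h' with rfl | h'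
  · exact (wf.eq_of_link hl hm (.inr h) hv.symm).symm
  -- A root has no parent, a parent is unique, and a child that repeats the core or the parent is
  -- excluded by `step`. Two children of `l` with the same value coincide because both have an empty
  -- position set.
  rcases h with ⟨a, ha, b, hb, rfl, rfl⟩ | h | ⟨Q, d, rfl⟩ <;>
    rcases h' with ⟨a', ha', b', hb', hl', rfl⟩ | h' | ⟨Q', d', rfl⟩
  · exact congrArg root hv
  · obtain ⟨Q, d, h'⟩ := h'
    cases h'
  · obtain rfl : b = d' := hv
    exact absurd ⟨a, ha, b, hb, rfl, rfl⟩ (wf.step_elt_elt hn.2 el en).2.1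
  · obtain ⟨Q, d, rfl⟩ := h
    cases hl'
  · exact h.parent_unique h'
  · exact absurd ⟨m, h, em, hv⟩ (wf.step_elt_elt hn.2 el en).2.2
  · obtain rfl : d = b' := hv
    exact absurd ⟨a', ha', d, hb', hl', rfl⟩ (wf.step_elt_elt hm.2 el em).2.1
  · exact absurd ⟨n, h', en, hv.symm⟩ (wf.step_elt_elt hm.2 el em).2.2
  · obtain rfl : d = d' := hv
    rw [(wf.step_elt_elt hn.2 el en).1, (wf.step_elt_elt hm.2 el em).1]

-- The exclusions in the first clause of `step` are exactly the cases in which a suitable copy of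
-- `b` is already linked to `n`.
omit wf in
theorem exists_link {n : UnravelNode D} (hn : J.validNode S Φ n) {b : D}
    (h : J.baseAdj n.val b) : ∃ m, J.validNode S Φ m ∧ m.val = b ∧ Link S n m := by
  by_cases h1 : b = n.val
  · exact ⟨n, hn, h1.symm, .inl rfl⟩
  by_cases h2 : RootPair S n (root b)
  · exact ⟨root b, trivial, rfl, .inr (.inl h2)⟩
  by_cases h3 : ∃ m, IsChild n m ∧ J.elt m.val ∧ m.val = b
  · obtain ⟨m, ⟨Q, d, rfl⟩, -, hm⟩ := h3
    exact ⟨m, hn.1, hm, .inr (.inr (.inl ⟨Q, d, rfl⟩))⟩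
  · exact ⟨child n ∅ b, ⟨hn, .inl ⟨rfl, h, h1, h2, h3⟩⟩, rfl, .inr (.inr (.inr ⟨_, _, rfl⟩))⟩

/-- An attached position is filled by a core root or by the parent, any other position by a child;
`conn` keeps the two sources apart. -/
theorem WellFormed.unravel_proj_unique {R : σ.Rel} {h : 2 < σ.arity R} (i : Fin (σ.arity R))
    (t : J.UnravelDom S Φ) (ht : (J.unravel S Φ).tup R h t) :
    ∃! a, (J.unravel S Φ).proj R h i t a := by
  obtain ⟨t, vt⟩ := t
  replace ht : J.tup R h t.val := ht
  obtain ⟨a, ha, hau⟩ := wf.proj_unique R h i t.val ht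
  have hpa : J.posVal i t.val a := (wf.posVal_iff ht i).2 ha
  by_cases hi : (i : ℕ) ∈ J.attached S t
  · cases t with
    | root t =>
      obtain ⟨hS, a', ha', hp⟩ := id hi
      obtain rfl := wf.posVal_unique hpa hp
      refine ⟨⟨root a, trivial⟩, ⟨ha, .inr ⟨hi, .inl ⟨t, hS, a, ha', rfl, rfl⟩⟩⟩, ?_⟩
      rintro ⟨b, vb⟩ ⟨hb, ⟨-, hb'⟩ | ⟨-, ⟨_, -, b', -, -, rfl⟩ | ⟨Q, d, hb'⟩⟩⟩
      · exact absurd hi hb'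
      · exact Subtype.ext (congrArg root (hau _ hb))
      · cases hb'
    | child m Q d =>
      -- All positions in `Q` carry the element of the parent.
      have hm : m.val = a := wf.posVal_unique ((wf.step_tup vt.2 ht).1 _ hi) hpa
      refine ⟨⟨m, vt.1⟩, ⟨hm ▸ ha, .inr ⟨hi, .inr ⟨Q, d, rfl⟩⟩⟩, ?_⟩
      rintro ⟨b, vb⟩ ⟨hb, ⟨-, hb'⟩ | ⟨-, hb' | hb'⟩⟩
      · exact absurd hi hb'
      · exact absurd ⟨Q, d, rfl⟩ hb'.not_isChild_left
      · exact Subtype.ext (hb'.parent_unique ⟨Q, d, rfl⟩)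
  · refine ⟨⟨child t ∅ a, vt, .inr (.inl ⟨rfl, i, hi, hpa⟩)⟩, ⟨ha, .inl ⟨⟨_, _, rfl⟩, hi⟩⟩, ?_⟩
    rintro ⟨b, vb⟩ hb
    rw [unravel_proj] at hb
    obtain ⟨hb, ⟨⟨Q, d, rfl⟩, -⟩ | ⟨hb', -⟩⟩ := hb
    · obtain rfl := wf.step_of_tup vb.2 ht
      obtain rfl : d = a := hau _ hb
      rfl
    · exact absurd hb' hi

theorem WellFormed.unravel : (J.unravel S Φ).WellFormed where
  cover a := wf.cover a.1.val
  elt_not_tup a := wf.elt_not_tup a.1.val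
  tup_disjoint a := wf.tup_disjoint a.1.val
  base_elt R h _ ha := wf.base_elt R h _ ha.1
  proj_typed R h i _ _ ha := wf.proj_typed R h i _ _ ha.1
  proj_unique _ _ i t ht := wf.unravel_proj_unique i t ht

end WellFormed

end Interp

/-! Matches of shredded conjunctions -/

section Shred

variable {σ : Signature.{v}} {D : Type u} {V : Type w}

theorem Interp.IsHom.isMatch {E : Type u} {T : Interp σ E} {J : Interp σ D} {p : E → D}
    (hp : T.IsHom J p) {f : V → E} {Ψ : Conj σ V} (hf : T.IsMatch f Ψ) :
    J.IsMatch (fun x => p (f x)) Ψ :=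
  fun A hA => hp _ _ (hf A hA)

theorem Atom.shred_low (b : Bool) (A : Atom σ V) (h : σ.arity A.rel ≤ 2) :
    A.shred b = [⟨ShredRel.base A.rel h, fun i => Sum.inl (A.args i)⟩] :=
  dif_pos h

theorem Atom.shred_high (b : Bool) (A : Atom σ V) (h : 2 < σ.arity A.rel) :
    A.shred b = ⟨ShredRel.tup A.rel h, fun _ => Sum.inr (b, A)⟩ ::
      List.ofFn (fun i : Fin (σ.arity A.rel) =>
        (⟨ShredRel.proj A.rel h i,
          (![Sum.inr (b, A), Sum.inl (A.args i)] : Fin 2 → V ⊕ Bool × Atom σ V)⟩ :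
          Atom σ.shred (V ⊕ Bool × Atom σ V))) :=
  dif_neg (not_le.mpr h)

theorem Interp.isMatch_shred_low {T : Interp σ.shred D} {g : V ⊕ Bool × Atom σ V → D} {b : Bool}
    {A : Atom σ V} (h : σ.arity A.rel ≤ 2) :
    T.IsMatch g (A.shred b) ↔ T.base A.rel h (fun i => g (Sum.inl (A.args i))) := by
  rw [Atom.shred_low b A h]
  simp only [IsMatch, List.mem_singleton, forall_eq]
  rfl

theorem Interp.isMatch_shred_high {T : Interp σ.shred D} {g : V ⊕ Bool × Atom σ V → D} {b : Bool}
    {A : Atom σ V} (h : 2 < σ.arity A.rel) :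
    T.IsMatch g (A.shred b) ↔ T.tup A.rel h (g (Sum.inr (b, A))) ∧
      ∀ i, T.proj A.rel h i (g (Sum.inr (b, A))) (g (Sum.inl (A.args i))) := by
  rw [Atom.shred_high b A h]
  simp only [IsMatch, List.mem_cons, forall_eq_or_imp, List.mem_ofFn, forall_exists_index,
    forall_apply_eq_imp_iff]
  exact and_congr Iff.rfl (forall_congr' fun i => rel_proj_iff T)

theorem Atom.vars_shred_inl {b : Bool} {A : Atom σ V} {x : V} :
    Sum.inl x ∈ Conj.vars (A.shred b) ↔ ∃ i, A.args i = x := by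
  rcases le_or_gt (σ.arity A.rel) 2 with h | h
  · rw [A.shred_low b h]
    simp only [Conj.vars, Set.mem_ofPred_eq, List.mem_singleton, exists_eq_left, Sum.inl.injEq]
    rfl
  · rw [A.shred_high b h]
    constructor
    · rintro ⟨B, hB, j, hj⟩
      rcases List.mem_cons.1 hB with rfl | hB
      · cases hj
      · obtain ⟨i, rfl⟩ := List.mem_ofFn.1 hB
        change Fin 2 at j
        fin_cases j
        · cases hj
        · exact ⟨i, Sum.inl.inj hj⟩
    · rintro ⟨i, rfl⟩
      exact ⟨_, List.mem_cons_of_mem _ (List.mem_ofFn.2 ⟨i, rfl⟩), (1 : Fin 2), rfl⟩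

theorem Atom.vars_shred_inr {b c : Bool} {A B : Atom σ V}
    (h : Sum.inr (c, B) ∈ Conj.vars (A.shred b)) : c = b := by
  rcases le_or_gt (σ.arity A.rel) 2 with h' | h'
  · rw [A.shred_low b h'] at h
    obtain ⟨C, hC, j, hj⟩ := h
    obtain rfl := List.mem_singleton.1 hC
    cases hj
  · rw [A.shred_high b h'] at h
    obtain ⟨C, hC, j, hj⟩ := h
    rcases List.mem_cons.1 hC with rfl | hC
    · cases hj
      rfl
    · obtain ⟨i, rfl⟩ := List.mem_ofFn.1 hC
      change Fin 2 at j
      fin_cases j <;> cases hj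
      rfl

theorem Conj.mem_vars_shred {b : Bool} {Ψ : Conj σ V} {y : V ⊕ Bool × Atom σ V} :
    y ∈ (Conj.shred b Ψ).vars ↔ ∃ A ∈ Ψ, y ∈ Conj.vars (A.shred b) := by
  simp only [Conj.shred, Conj.vars, Set.mem_ofPred_eq, List.mem_flatMap]
  constructor
  · rintro ⟨B, ⟨A, hA, hB⟩, h⟩
    exact ⟨A, hA, B, hB, h⟩
  · rintro ⟨A, hA, B, hB, h⟩
    exact ⟨B, ⟨A, hA, hB⟩, h⟩

theorem Conj.vars_shred_inl {b : Bool} {Ψ : Conj σ V} {x : V} :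
    Sum.inl x ∈ (Conj.shred b Ψ).vars ↔ x ∈ Ψ.vars := by
  simp only [mem_vars_shred, Atom.vars_shred_inl]
  rfl

theorem Conj.vars_shred_inr {b c : Bool} {Ψ : Conj σ V} {A : Atom σ V}
    (h : Sum.inr (c, A) ∈ (Conj.shred b Ψ).vars) : c = b := by
  obtain ⟨B, -, hB⟩ := mem_vars_shred.1 h
  exact Atom.vars_shred_inr hB

theorem Rule.isMatch_shred_head {T : Interp σ.shred D} {g : V ⊕ Bool × Atom σ V → D}
    {τ : Rule σ V} {A : Atom σ V} (hA : τ.head = [A]) :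
    T.IsMatch g τ.shred.head ↔ T.IsMatch g (A.shred true) := by
  simp [Rule.shred, hA, Conj.shred]

/-- An assignment of the body variables extends to the head when the values of the head positions
respect the equalities between the variables. -/
theorem Rule.exists_extension {τ : Rule σ V} {A : Atom σ V} (f : V ⊕ Bool × Atom σ V → D) (t : D)
    (a : Fin (σ.arity A.rel) → D) (ha : ∀ i, A.args i ∈ τ.body.vars → a i = f (Sum.inl (A.args i)))
    (haa : ∀ i j, A.args i = A.args j → a i = a j) :
    ∃ g : V ⊕ Bool × Atom σ V → D, (∀ x ∈ τ.shred.body.vars, g x = f x) ∧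
      g (Sum.inr (true, A)) = t ∧ ∀ i, g (Sum.inl (A.args i)) = a i := by
  classical
  refine ⟨fun y => match y with
    | .inl y => if y ∈ τ.body.vars then f (.inl y) else
        if h : ∃ i, A.args i = y then a h.choose else f (.inl y)
    | .inr (true, _) => t
    | .inr (false, B) => f (.inr (false, B)), ?_, rfl, ?_⟩
  · rintro (y | ⟨_ | _, B⟩) hy
    · exact if_pos (Conj.vars_shred_inl.1 hy)
    · rfl
    · exact absurd (Conj.vars_shred_inr hy) (by simp)
  · intro i
    by_cases hi : A.args i ∈ τ.body.vars
    · exact (if_pos hi).trans (ha i hi).symm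
    · have h : ∃ j, A.args j = A.args i := ⟨i, rfl⟩
      -- By `haa`, the index chosen for the variable does not matter.
      refine (if_neg hi).trans ((dif_pos h).trans (haa _ _ h.choose_spec))

end Shred

namespace Interp

variable {σ : Signature.{v}} {D : Type u} {J : Interp σ.shred D} {S : Set D} {Φ : Set (FD σ)}

/-! Functional dependencies in the unraveling -/

theorem conn.cases {k : ℕ} {t a : UnravelNode D} (h : J.conn S k t a) :
    (RootPair S t a ∨ IsChild a t) ∨ IsChild t a := by
  rcases h with h | ⟨-, h | h⟩
  · exact .inl (.inr h.1)
  · exact .inl (.inl h)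
  · exact .inr h

theorem conn.mem {k : ℕ} {a : UnravelNode D} {Q : Set ℕ} {d : D}
    (h : J.conn S k (child a Q d) a) : k ∈ Q := by
  rcases h with ⟨h, -⟩ | ⟨h, -⟩
  · have := h.depth_eq
    simp only [depth] at this
    omega
  · exact h

/-- Being attached at a whole determiner rules out `detFree`, and minimality then leaves no room
between `φ.det` and `Q`. So only the chosen tuple can occur here. -/
theorem WellFormed.child_determiner (wf : J.WellFormed) {φ : FD σ} (hφ : φ ∈ Φ)
    {a : UnravelNode D} {Q : Set ℕ} {d : D} (hs : J.step S Φ a Q d)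
    (hd : J.tup φ.rel φ.higher d) (h : ∀ i ∈ φ.det, J.conn S i (child a Q d) a) :
    Q = Fin.val '' φ.det ∧ d = J.pick φ.rel Q a.val ∧ ¬ J.blocked S a φ.rel Q := by
  have hQ : Fin.val '' φ.det ⊆ Q := by
    rintro _ ⟨i, hi, rfl⟩
    exact (h i hi).mem
  rcases (wf.step_tup hs hd).2 with hf | ⟨ψ, -, -, hψd, hmin, hpick, hbl⟩
  · exact absurd hQ (hf φ hφ hd)
  · have hr := wf.tup_disjoint _ _ _ _ _ hψd hd
    rw [hr] at hpick hbl
    refine ⟨?_, hpick, hbl⟩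
    by_contra hne
    exact hmin φ hφ hd (hQ.ssubset_of_ne (Ne.symm hne))

/-- Two tuples that share `a` at a determiner are core roots or parents of `a`, or else children of
`a`. Two children are the same chosen tuple, two parents coincide, and a child next to a tuple of
the first kind contradicts blocking (`main`). Only pairs in the core remain. -/
theorem WellFormed.unravel_fdSafeExcept (wf : J.WellFormed) :
    (J.unravel S Φ).FDSafeExcept Φ {n | ∃ a ∈ S, n.1 = root a} := by
  have main : ∀ φ ∈ Φ, ∀ t t' a : J.UnravelDom S Φ,
      (∀ i ∈ φ.det, (J.unravel S Φ).proj φ.rel φ.higher i t a) →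
      (∀ i ∈ φ.det, (J.unravel S Φ).proj φ.rel φ.higher i t' a) →
      (RootPair S t.1 a.1 ∨ IsChild a.1 t.1) → ¬ IsChild t'.1 a.1 := by
    rintro φ hφ t ⟨t', vt'⟩ a h h' hab ⟨Q, d, rfl⟩
    obtain ⟨i₀, hi₀⟩ := φ.det_nonempty
    obtain ⟨rfl, -, hbl⟩ := wf.child_determiner hφ vt'.2
      (wf.proj_typed _ _ _ _ _ (h' _ hi₀).1).1 (fun i hi => (h' i hi).2)
    -- The tuple `t` itself blocks the creation of `t'`.
    refine hbl ⟨t.1, hab, ⟨_, (wf.proj_typed _ _ _ _ _ (h _ hi₀).1).1⟩, ?_⟩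
    rintro _ ⟨i, hi, rfl⟩
    exact ⟨⟨_, _, i, rfl, (h i hi).1⟩, (h i hi).2⟩
  intro φ hφ t t' a hne h h'
  have hc := fun i hi => unravel_proj.1 (h i hi)
  have hc' := fun i hi => unravel_proj.1 (h' i hi)
  obtain ⟨i₀, hi₀⟩ := id φ.det_nonempty
  have ht := (wf.proj_typed _ _ _ _ _ (hc _ hi₀).1).1
  have ht' := (wf.proj_typed _ _ _ _ _ (hc' _ hi₀).1).1
  rcases (hc _ hi₀).2.cases with c | c <;> rcases (hc' _ hi₀).2.cases with c' | c'
  · rcases c with ⟨b, hb, d, hd, e, e₁⟩ | c <;> rcases c' with ⟨b', hb', d', hd', e', e₁'⟩ | c'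
    · exact ⟨⟨b, hb, e⟩, ⟨b', hb', e'⟩⟩
    · rw [e₁] at c'
      obtain ⟨_, _, c'⟩ := c'
      cases c'
    · rw [e₁'] at c
      obtain ⟨_, _, c⟩ := c
      cases c
    · exact absurd (Subtype.ext (c.parent_unique c')) hne
  · exact absurd c' (main φ hφ t t' a h h' c)
  · exact absurd c (main φ hφ t' t a h' h c')
  · refine absurd (Subtype.ext ?_) hne
    obtain ⟨t, vt⟩ := t
    obtain ⟨t', vt'⟩ := t'
    obtain ⟨Q, d, rfl⟩ := c
    obtain ⟨Q', d', rfl⟩ := c'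
    obtain ⟨rfl, e, -⟩ := wf.child_determiner hφ vt.2 ht (fun i hi => (hc i hi).2)
    obtain ⟨rfl, e', -⟩ := wf.child_determiner hφ vt'.2 ht' (fun i hi => (hc' i hi).2)
    exact congrArg (child a.1 _) (e.trans e'.symm)

/-! Rules in the unraveling -/

theorem WellFormed.exists_child_tuple (wf : J.WellFormed) {a : J.UnravelDom S Φ}
    {R : σ.Rel} {h : 2 < σ.arity R} {t : D} (ht : J.tup R h t) (ha : J.elt a.1.val)
    {P : Set (Fin (σ.arity R))} (hP : ∀ i ∈ P, J.proj R h i t a.1.val)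
    (hs : J.detFree Φ (Fin.val '' P) t ∨ J.detMinimal S Φ a.1 (Fin.val '' P) t) :
    ∃ n : J.UnravelDom S Φ, n.1 = child a.1 (Fin.val '' P) t ∧
      ∀ i ∈ P, (J.unravel S Φ).proj R h i n a := by
  refine ⟨⟨child a.1 (Fin.val '' P) t, a.2, .inr (.inr ⟨ha, ⟨R, h, ht⟩, ?_, hs⟩)⟩, rfl, ?_⟩
  · rintro _ ⟨i, hi, rfl⟩
    exact (wf.posVal_iff ht i).2 (hP i hi)
  · exact fun i hi => ⟨hP i hi, .inr ⟨⟨i, hi, rfl⟩, .inr ⟨_, _, rfl⟩⟩⟩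

/-- If the node is blocked, the blocking tuple serves; otherwise the chosen tuple was added as a
child. Neither need agree with `t` outside `φ.det`. -/
theorem WellFormed.exists_tuple_of_minimal (wf : J.WellFormed) {a : J.UnravelDom S Φ}
    {φ : FD σ} (hφ : φ ∈ Φ) {t : D} (ht : J.tup φ.rel φ.higher t)
    (hP : ∀ i ∈ φ.det, J.proj φ.rel φ.higher i t a.1.val)
    (hmin : ∀ d, J.tup φ.rel φ.higher d → ∀ ψ ∈ Φ, J.tup ψ.rel ψ.higher d →
      ¬ Fin.val '' ψ.det ⊂ Fin.val '' φ.det) :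
    ∃ n : J.UnravelDom S Φ, (J.unravel S Φ).tup φ.rel φ.higher n ∧
      ∀ i ∈ φ.det, (J.unravel S Φ).proj φ.rel φ.higher i n a := by
  by_cases hb : J.blocked S a.1 φ.rel (Fin.val '' φ.det)
  · obtain ⟨n, hn, ⟨_, ht'⟩, hc⟩ := hb
    have hv : J.validNode S Φ n := by
      rcases hn with ⟨b, -, c, -, rfl, -⟩ | ⟨Q, d, hn⟩
      · trivial
      · have := a.2
        rw [hn] at this
        exact this.1
    refine ⟨⟨n, hv⟩, ht', fun i hi => ?_⟩
    obtain ⟨h₁, h₂⟩ := hc i ⟨i, hi, rfl⟩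
    exact ⟨(wf.posVal_iff ht' i).1 h₁, h₂⟩
  · have hex : ∃ t, (∃ h, J.tup φ.rel h t) ∧ ∀ k ∈ Fin.val '' φ.det, J.posVal k t a.1.val := by
      refine ⟨t, ⟨_, ht⟩, ?_⟩
      rintro _ ⟨i, hi, rfl⟩
      exact (wf.posVal_iff ht i).2 (hP i hi)
    obtain ⟨⟨_, hd⟩, hk⟩ := @Classical.epsilon_spec D _ hex
    obtain ⟨i₀, hi₀⟩ := id φ.det_nonempty
    obtain ⟨n, hn, hn'⟩ := wf.exists_child_tuple (S := S) (Φ := Φ) (a := a)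
      (t := J.pick φ.rel (Fin.val '' φ.det) a.1.val) hd (wf.proj_typed _ _ _ _ _ (hP _ hi₀)).2
      (fun i hi => (wf.posVal_iff hd i).1 (hk i ⟨i, hi, rfl⟩))
      (.inr ⟨φ, hφ, rfl, hd, hmin _ hd, rfl, hb⟩)
    refine ⟨n, ?_, hn'⟩
    rw [unravel_tup, hn]
    exact hd

theorem WellFormed.exists_child_value (wf : J.WellFormed) {n : J.UnravelDom S Φ} {R : σ.Rel}
    {h : 2 < σ.arity R} (hn : J.tup R h n.1.val) {i : Fin (σ.arity R)} {b : D}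
    (hi : (i : ℕ) ∉ J.attached S n.1) (hb : J.proj R h i n.1.val b) :
    ∃ hv : J.validNode S Φ (child n.1 ∅ b), (J.unravel S Φ).proj R h i n ⟨_, hv⟩ :=
  ⟨⟨n.2, .inr (.inl ⟨rfl, i, hi, (wf.posVal_iff hn i).2 hb⟩)⟩, hb, .inl ⟨⟨_, _, rfl⟩, hi⟩⟩

/-- With arity at most two, at most one position other than `i₀` has to be lifted; if there is none,
`a` itself serves as `b`. -/
theorem unravel_lift_base {a : J.UnravelDom S Φ} {R : σ.Rel} (h : σ.arity R ≤ 2)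
    {c : Fin (σ.arity R) → D} (hc : J.base R h c) {i₀ : Fin (σ.arity R)} (hi₀ : c i₀ = a.1.val) :
    ∃ b : J.UnravelDom S Φ, Link S a.1 b.1 ∧ ∀ i, i ≠ i₀ → b.1.val = c i := by
  by_cases hj : ∃ j, j ≠ i₀
  · obtain ⟨j, hj⟩ := hj
    obtain ⟨m, vm, hm, hl⟩ := exists_link a.2 (b := c j) ⟨R, h, c, hc, ⟨i₀, hi₀⟩, j, rfl⟩
    refine ⟨⟨m, vm⟩, hl, fun i hi => ?_⟩
    have : i = j := by
      have := i.2
      have := j.2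
      have := i₀.2
      rw [Ne, Fin.ext_iff] at hi hj
      ext
      omega
    rw [this]
    exact hm
  · exact ⟨a, .inl rfl, fun i hi => absurd ⟨i, hi⟩ hj⟩

theorem WellFormed.unravel_satRule (wf : J.WellFormed) {V : Type w} {τ : Rule σ V}
    (h₁ : τ.FrontierOne) (h₂ : τ.NonConflicting Φ) (hJ : J.SatRule τ.shred) :
    (J.unravel S Φ).SatRule τ.shred := by
  classical
  intro f hf
  obtain ⟨g, hg, hgm⟩ := hJ _ (unravel_isHom.isMatch hf)
  obtain ⟨⟨A, hA⟩, hnc⟩ := h₂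
  obtain ⟨x, hx⟩ := h₁
  have hx' : x ∈ τ.frontier := hx ▸ rfl
  obtain ⟨i₀, hi₀⟩ : ∃ i, A.args i = x := by
    obtain ⟨B, hB, i, hi⟩ := hx'.2
    rw [hA] at hB
    obtain rfl := List.mem_singleton.1 hB
    exact ⟨i, hi⟩
  have hfr : ∀ i, A.args i ∈ τ.frontier ↔ A.args i = x := fun i => by rw [hx]; rfl
  -- Frontier-one: the match of the body fixes the head only at the positions of `x`.
  have hbody : ∀ i, A.args i ∈ τ.body.vars → A.args i = x := fun i hi =>
    (hfr i).1 ⟨hi, A, by rw [hA]; exact List.mem_singleton.2 rfl, i, rfl⟩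
  have hgx : g (.inl x) = (f (.inl x)).1.val := hg _ (Conj.vars_shred_inl.2 hx'.1)
  rw [Rule.isMatch_shred_head hA] at hgm
  rcases le_or_gt (σ.arity A.rel) 2 with har | har
  · rw [isMatch_shred_low har] at hgm
    obtain ⟨b, hb, hbv⟩ := unravel_lift_base (a := f (.inl x)) har hgm (i₀ := i₀)
      (by simp only [hi₀, hgx])
    obtain ⟨g', hg', -, hga⟩ := Rule.exists_extension (τ := τ) (A := A) f b
      (fun i => if A.args i = x then f (.inl x) else b)
      (fun i hi => by simp only [hbody i hi, if_true])
      (fun i j hij => by simp only [hij])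
    refine ⟨g', hg', (Rule.isMatch_shred_head hA).2 ((isMatch_shred_low har).2 ?_)⟩
    simp only [hga]
    refine unravel_base.2 ⟨?_, fun i j => ?_⟩
    · convert hgm using 2 with i
      split_ifs with hi
      · rw [hi, hgx]
      · exact hbv i (fun h => hi (h ▸ hi₀))
    · split_ifs
      · exact .inl rfl
      · exact hb
      · exact hb.symm
      · exact .inl rfl
  · rw [isMatch_shred_high har] at hgm
    obtain ⟨ht, hp⟩ := hgm
    suffices H : ∃ (n : J.UnravelDom S Φ) (a : Fin (σ.arity A.rel) → J.UnravelDom S Φ),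
        (J.unravel S Φ).tup A.rel har n ∧ (∀ i, (J.unravel S Φ).proj A.rel har i n (a i)) ∧
        (∀ i, A.args i = x → a i = f (.inl x)) ∧ ∀ i j, A.args i = A.args j → a i = a j by
      obtain ⟨n, a, hn, hna, hax, haa⟩ := H
      obtain ⟨g', hg', hgn, hga⟩ := Rule.exists_extension (τ := τ) (A := A) f n a
        (fun i hi => by rw [hax i (hbody i hi), hbody i hi]) haa
      refine ⟨g', hg', (Rule.isMatch_shred_head hA).2 ((isMatch_shred_high har).2 ?_)⟩
      simp only [hga, hgn]
      exact ⟨hn, hna⟩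
    have hpx : ∀ i, A.args i = x → J.proj A.rel har i (g (.inr (true, A))) (f (.inl x)).1.val :=
      fun i hi => by
        have := hp i
        rwa [hi, hgx] at this
    -- Without a determiner among the frontier positions, the tuple of `J` is copied as a child
    -- attached exactly there.
    by_cases hd : J.detFree Φ (Fin.val '' {i | A.args i = x}) (g (.inr (true, A)))
    · obtain ⟨n, hn, hnx⟩ := wf.exists_child_tuple (S := S) (a := f (.inl x)) ht
        (wf.proj_typed _ _ _ _ _ (hpx i₀ hi₀)).2 hpx (.inl hd)
      have hnv : n.1.val = g (.inr (true, A)) := by rw [hn]; rfl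
      have hch : ∀ i, A.args i ≠ x → ∃ hv : J.validNode S Φ (child n.1 ∅ (g (.inl (A.args i)))),
          (J.unravel S Φ).proj A.rel har i n ⟨_, hv⟩ := fun i hi =>
        wf.exists_child_value (hnv ▸ ht) (by
          rw [hn]
          rintro ⟨j, hj, hij⟩
          exact hi (Fin.ext hij ▸ hj)) (hnv ▸ hp i)
      -- The child at an existential position depends only on its value in `J`, so repeated
      -- existential variables receive the same node.
      refine ⟨n, fun i => if hi : A.args i = x then f (.inl x) else ⟨_, (hch i hi).1⟩,
        unravel_tup.2 (hnv ▸ ht), fun i => ?_, fun i hi => dif_pos hi, fun i j hij => ?_⟩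
      · dsimp only
        split_ifs with hi
        · exact hnx i hi
        · exact (hch i hi).2
      · simp only [hij]
    · simp only [detFree, not_forall, not_not] at hd
      obtain ⟨φ, hφ, hφt, hsub⟩ := hd
      obtain ⟨R, z⟩ := A
      obtain rfl : φ.rel = R := wf.tup_disjoint _ _ _ _ _ hφt ht
      have hset : {i | z i ∈ τ.frontier} = {i | z i = x} := Set.ext hfr
      replace hsub : φ.det ⊆ {i | z i = x} := (Set.image_subset_image_iff Fin.val_injective).1 hsub
      obtain ⟨hns, huniq⟩ := hnc φ hφ z hA
      rw [hset] at hns huniq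
      have heq : φ.det = {i | z i = x} := by
        by_contra hne
        exact hns (hsub.ssubset_of_ne hne)
      obtain ⟨n, hn, hnx⟩ := wf.exists_tuple_of_minimal (S := S) (a := f (.inl x)) hφ ht
        (fun i hi => hpx i (hsub hi)) (by
          -- A smaller determiner would be strictly contained in the frontier positions, against
          -- non-conflictingness.
          intro d hd ψ hψ hψd hlt
          obtain ⟨R', h', P, hP, r⟩ := ψ
          obtain rfl : φ.rel = R' := wf.tup_disjoint _ _ _ _ _ hd hψd
          refine (hnc _ hψ z hA).1 ?_
          rw [hset, ← heq]
          exact ((Fin.val_injective.injOn (s := Set.univ)).image_ssubset_image_iff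
            (Set.subset_univ _) (Set.subset_univ _)).1 hlt)
      have hTwf := wf.unravel (S := S) (Φ := Φ)
      choose a ha hau using fun i => hTwf.proj_unique _ har i n hn
      have hax : ∀ i, z i = x → a i = f (.inl x) := fun i hi =>
        (hau i _ (hnx i (heq ▸ hi))).symm
      refine ⟨n, a, hn, ha, hax, fun i j hij => ?_⟩
      by_cases hi : z i = x
      · rw [hax i hi, hax j ((Eq.symm hij).trans hi)]
      · rw [huniq heq i j (fun h => hi ((hfr i).1 h)) hij]

end Interp

/-! Guarded two-variable sentences -/

theorem C2.sat_congr {σ : Signature.{v}} {D : Type u} (J : Interp σ D) (φ : C2 σ)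
    {f g : Fin 2 → D} (h : ∀ x ∈ φ.free, f x = g x) : φ.Sat J f ↔ φ.Sat J g := by
  induction φ generalizing f g with
  | eq x y =>
    simp only [Sat]
    rw [h x (.inl rfl), h y (.inr rfl)]
  | rel R args =>
    simp only [Sat]
    rw [funext fun i => h (args i) ⟨i, rfl⟩]
  | neg φ ih => exact not_congr (ih h)
  | and φ ψ ih₁ ih₂ =>
    exact and_congr (ih₁ fun x hx => h x (.inl hx)) (ih₂ fun x hx => h x (.inr hx))
  | exGe n x φ ih =>
    simp only [Sat]
    have : ∀ d, φ.Sat J (Function.update f x d) ↔ φ.Sat J (Function.update g x d) := fun d =>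
      ih fun y hy => by
        by_cases hyx : y = x
        · subst hyx
          simp
        · simp only [Function.update_of_ne hyx]
          exact h y ⟨hy, hyx⟩
    simp only [this]

theorem Fin.eq_or_eq_of_ne {x y : Fin 2} (h : x ≠ y) (z : Fin 2) : z = x ∨ z = y := by
  omega

namespace Interp

variable {σ : Signature.{v}} {D : Type u} {J : Interp σ.shred D} {S : Set D} {Φ : Set (FD σ)}

theorem guard_eq_or_baseAdj {γ : C2 σ.low} (hγ : γ.IsGuard) {f : Fin 2 → D}
    (h : γ.Sat J.low f) (x y : Fin 2) : f x = f y ∨ J.baseAdj (f x) (f y) := by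
  cases γ with
  | eq z w =>
    left
    have h : f z = f w := h
    rcases Fin.eq_or_eq_of_ne hγ x with rfl | rfl <;>
      rcases Fin.eq_or_eq_of_ne hγ y with rfl | rfl <;> simp [h]
  | rel R args =>
    right
    obtain ⟨i, rfl⟩ := hγ x
    obtain ⟨j, rfl⟩ := hγ y
    exact ⟨R.1, R.2, _, h, ⟨i, rfl⟩, j, rfl⟩
  | _ => exact hγ.elim

theorem unravel_guard_link {γ : C2 σ.low} (hγ : γ.IsGuard) {f : Fin 2 → J.UnravelDom S Φ}
    (h : γ.Sat (J.unravel S Φ).low f) (x y : Fin 2) : Link S (f x).1 (f y).1 := by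
  cases γ with
  | eq z w =>
    left
    have h : f z = f w := h
    rcases Fin.eq_or_eq_of_ne hγ x with rfl | rfl <;>
      rcases Fin.eq_or_eq_of_ne hγ y with rfl | rfl <;> simp [h]
  | rel R args =>
    obtain ⟨i, rfl⟩ := hγ x
    obtain ⟨j, rfl⟩ := hγ y
    exact h.2 i j
  | _ => exact hγ.elim

theorem WellFormed.unravel_guard_iff (wf : J.WellFormed) {γ : C2 σ.low} (hγ : γ.IsGuard)
    {f : Fin 2 → J.UnravelDom S Φ} (hf : ∀ x y, Link S (f x).1 (f y).1) :
    γ.Sat (J.unravel S Φ).low f ↔ γ.Sat J.low (fun x => (f x).1.val) := by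
  cases γ with
  | eq x y =>
    exact ⟨fun h => congrArg (fun n : J.UnravelDom S Φ => n.1.val) h,
      fun h => Subtype.ext (wf.eq_of_link (f x).2 (f y).2 (hf x y) h)⟩
  | rel R args => exact and_iff_left fun i j => hf _ _
  | _ => exact hγ.elim

theorem val_comp_update {f : Fin 2 → J.UnravelDom S Φ} (x : Fin 2) (d : J.UnravelDom S Φ) :
    (fun y => (Function.update f x d y).1.val) =
      Function.update (fun y => (f y).1.val) x d.1.val :=
  Function.comp_update (fun n : J.UnravelDom S Φ => n.1.val) f x d

/-- The copies that satisfy a guarded formula together with a given node correspond to the elements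
that satisfy it together with the element of that node. -/
theorem WellFormed.unravel_guarded_encard (wf : J.WellFormed) {γ φ : C2 σ.low} (hγ : γ.IsGuard)
    (x : Fin 2) (ih : ∀ f : Fin 2 → J.UnravelDom S Φ, (∀ x y, Link S (f x).1 (f y).1) →
      (φ.Sat (J.unravel S Φ).low f ↔ φ.Sat J.low (fun x => (f x).1.val)))
    (f : Fin 2 → J.UnravelDom S Φ) :
    {d | (γ.and φ).Sat (J.unravel S Φ).low (Function.update f x d)}.encard =
      {d | (γ.and φ).Sat J.low (Function.update (fun y => (f y).1.val) x d)}.encard := by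
  obtain ⟨y, hyx⟩ : ∃ y, y ≠ x := ⟨1 - x, by omega⟩
  -- The set counted in `J` is the image under `val` of the set counted in the unraveling;
  -- injectivity of `val` on the latter follows from unique lifting.
  have himg : {d | (γ.and φ).Sat J.low (Function.update (fun y => (f y).1.val) x d)} =
      (fun n : J.UnravelDom S Φ => n.1.val) ''
        {d | (γ.and φ).Sat (J.unravel S Φ).low (Function.update f x d)} := by
    ext d
    constructor
    · rintro ⟨h₁, h₂⟩
      have hd := guard_eq_or_baseAdj hγ h₁ y x
      simp only [Function.update_of_ne hyx, Function.update_self] at hd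
      obtain ⟨m, hm, hl⟩ : ∃ m : J.UnravelDom S Φ, m.1.val = d ∧ Link S (f y).1 m.1 := by
        rcases hd with hd | hd
        · exact ⟨f y, hd, .inl rfl⟩
        · obtain ⟨m, vm, hm, hl⟩ := exists_link (f y).2 hd
          exact ⟨⟨m, vm⟩, hm, hl⟩
      subst hm
      have hlink : ∀ z w, Link S (Function.update f x m z).1 (Function.update f x m w).1 := by
        intro z w
        rcases Fin.eq_or_eq_of_ne hyx z with rfl | rfl <;>
          rcases Fin.eq_or_eq_of_ne hyx w with rfl | rfl
        · exact .inl rfl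
        · simpa only [Function.update_of_ne hyx, Function.update_self] using hl
        · simpa only [Function.update_of_ne hyx, Function.update_self] using hl.symm
        · exact .inl rfl
      refine ⟨m, ⟨(wf.unravel_guard_iff hγ hlink).2 ?_, (ih _ hlink).2 ?_⟩, rfl⟩
      · rw [val_comp_update]
        exact h₁
      · rw [val_comp_update]
        exact h₂
    · rintro ⟨m, ⟨h₁, h₂⟩, rfl⟩
      have hlink := unravel_guard_link hγ h₁
      refine ⟨?_, ?_⟩
      · rw [← val_comp_update]
        exact (wf.unravel_guard_iff hγ hlink).1 h₁
      · rw [← val_comp_update]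
        exact (ih _ hlink).1 h₂
  rw [himg, Set.InjOn.encard_image]
  rintro m ⟨hm, -⟩ n ⟨hn, -⟩ (hv : m.1.val = n.1.val)
  have lm := unravel_guard_link hγ hm
  have ln := unravel_guard_link hγ hn
  have am := guard_eq_or_baseAdj hγ ((wf.unravel_guard_iff hγ lm).1 hm) y x
  replace lm := lm y x
  replace ln := ln y x
  simp only [Function.update_of_ne hyx, Function.update_self] at am lm ln
  rcases am with am | am
  · have e₁ := wf.eq_of_link (f y).2 m.2 lm am
    have e₂ := wf.eq_of_link (f y).2 n.2 ln (am.trans hv)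
    exact Subtype.ext (e₁.symm.trans e₂)
  · exact Subtype.ext (wf.link_unique (f y).2 m.2 n.2 (wf.baseAdj_elt am).1
      (wf.baseAdj_elt am).2 lm ln hv)

/-- Atoms are reflected by `val` only between linked nodes, hence `hf`. Guards restore this
hypothesis under counting quantifiers; under a plain quantifier only one variable is free, and a
constant assignment is trivially linked. -/
theorem WellFormed.unravel_sat_iff (wf : J.WellFormed) {φ : C2 σ.low} (hφ : φ.IsGC2)
    (f : Fin 2 → J.UnravelDom S Φ) (hf : ∀ x y, Link S (f x).1 (f y).1) :
    φ.Sat (J.unravel S Φ).low f ↔ φ.Sat J.low (fun x => (f x).1.val) := by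
  induction hφ generalizing f with
  | eq x y =>
    exact ⟨fun h => congrArg (fun n : J.UnravelDom S Φ => n.1.val) h,
      fun h => Subtype.ext (wf.eq_of_link (f x).2 (f y).2 (hf x y) h)⟩
  | rel R args => exact and_iff_left fun i j => hf _ _
  | neg _ ih => exact not_congr (ih f hf)
  | and _ _ ih₁ ih₂ => exact and_congr (ih₁ f hf) (ih₂ f hf)
  | ex x _ hfree ih =>
    rename_i ψ _
    have key : ∀ d : J.UnravelDom S Φ,
        ψ.Sat (J.unravel S Φ).low (Function.update f x d) ↔
          ψ.Sat J.low (Function.update (fun y => (f y).1.val) x d.1.val) := by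
      intro d
      rw [C2.sat_congr (g := fun _ => d), C2.sat_congr (g := fun _ => d.1.val)]
      · exact ih (fun _ => d) fun _ _ => .inl rfl
      · intro y hy
        obtain rfl := hfree hy
        simp
      · intro y hy
        obtain rfl := hfree hy
        simp
    simp only [C2.Sat, Nat.cast_one, Set.one_le_encard_iff_nonempty]
    constructor
    · rintro ⟨d, hd⟩
      exact ⟨d.1.val, (key d).1 hd⟩
    · rintro ⟨d, hd⟩
      -- Unguarded witnesses exist because every element of `D`, in `S` or not, has a root copy.
      exact ⟨⟨root d, trivial⟩, (key ⟨root d, trivial⟩).2 hd⟩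
  | guarded n x hγ _ ih =>
    have := wf.unravel_guarded_encard hγ x ih f
    simp only [C2.Sat] at this ⊢
    rw [this]

theorem WellFormed.unravel_satC2 (wf : J.WellFormed) {θ : C2 σ.low} (hθ : θ.IsConstraint)
    (h : J.low.SatC2 θ) : (J.unravel S Φ).low.SatC2 θ := by
  intro f
  rw [C2.sat_congr (g := fun _ => f 0) _ _ (by simp [hθ.2])]
  exact (wf.unravel_sat_iff hθ.1 _ fun _ _ => .inl rfl).2 (h _)

/-! Cycles -/

theorem unravel_link_of_adj {m n : J.UnravelDom S Φ} (h : (J.unravel S Φ).gaifman.Adj m n) :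
    Link S m.1 n.1 := by
  obtain ⟨hne, R, c, hc, ⟨i, rfl⟩, j, rfl⟩ := h
  cases R with
  | base R hR => exact hc.2 i j
  | elt | tup R hR => exact absurd (congrArg c (Subsingleton.elim (α := Fin 1) i j)) hne
  | proj R hR k =>
    have hl : Link S (c (0 : Fin 2)).1 (c (1 : Fin 2)).1 := by
      rcases hc.2.cases with (h | h) | h
      · exact .inr (.inl h)
      · exact .inr (.inr (.inr h))
      · exact .inr (.inr (.inl h))
    change Fin 2 at i j
    fin_cases i <;> fin_cases j
    · exact absurd rfl hne
    · exact hl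
    · exact hl.symm
    · exact absurd rfl hne

/-- A deepest node of a cycle has two distinct neighbours on it, and at most one is its parent, so
it has a core neighbour and is a root. Then the whole cycle has depth zero, where only core roots
are adjacent. -/
theorem unravel_cycleFreeExcept :
    (J.unravel S Φ).CycleFreeExcept {n | ∃ a ∈ S, n.1 = root a} := by
  intro a c hc
  have hadj : ∀ m ∈ c.support, ∃ l n, l ≠ n ∧ l ∈ c.support ∧ n ∈ c.support ∧
      (J.unravel S Φ).gaifman.Adj m l ∧ (J.unravel S Φ).gaifman.Adj m n := by
    intro m hm
    obtain ⟨l, n, hln, hset⟩ := Set.ncard_eq_two.1 (hc.ncard_neighborSet_toSubgraph_eq_two hm)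
    have hl : c.toSubgraph.Adj m l := by
      have : l ∈ c.toSubgraph.neighborSet m := hset ▸ .inl rfl
      exact this
    have hn : c.toSubgraph.Adj m n := by
      have : n ∈ c.toSubgraph.neighborSet m := hset ▸ .inr rfl
      exact this
    exact ⟨l, n, hln, c.mem_verts_toSubgraph.1 hl.snd_mem, c.mem_verts_toSubgraph.1 hn.snd_mem,
      hl.adj_sub, hn.adj_sub⟩
  have hlink : ∀ {m n : J.UnravelDom S Φ}, (J.unravel S Φ).gaifman.Adj m n →
      RootPair S m.1 n.1 ∨ IsChild m.1 n.1 ∨ IsChild n.1 m.1 := fun h =>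
    (unravel_link_of_adj h).resolve_left fun e => h.ne (Subtype.ext e)
  obtain ⟨m, hm, hmax⟩ := Set.exists_max_image {m | m ∈ c.support} (fun m => m.1.depth)
    (List.finite_toSet _) ⟨a, c.start_mem_support⟩
  have hparent : ∀ l ∈ c.support, (J.unravel S Φ).gaifman.Adj m l →
      RootPair S m.1 l.1 ∨ IsChild m.1 l.1 := by
    intro l hl h
    rcases hlink h with h | h | h
    · exact .inl h
    · exact .inr h
    · have h₁ := h.depth_eq
      have h₂ : l.1.depth ≤ m.1.depth := hmax l hl
      omega
  have hzero : m.1.depth = 0 := by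
    obtain ⟨l, n, hln, hl, hn, hml, hmn⟩ := hadj m hm
    rcases hparent l hl hml with ⟨b, -, d, -, e, -⟩ | h
    · rw [e]
      rfl
    · rcases hparent n hn hmn with ⟨b, -, d, -, e, -⟩ | h'
      · rw [e]
        rfl
      · exact absurd (Subtype.ext (h.parent_unique h')) hln
  have hdepth : ∀ n ∈ c.support, n.1.depth = 0 := fun n hn => by
    have : n.1.depth ≤ m.1.depth := hmax n hn
    omega
  intro b hb
  obtain ⟨l, -, -, hl, -, hbl, -⟩ := hadj b hb
  have h₁ := hdepth b hb
  have h₂ := hdepth l hl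
  rcases hlink hbl with ⟨d, hd, -, -, e, -⟩ | h | h
  · exact ⟨d, hd, e⟩
  · have := h.depth_eq
    omega
  · have := h.depth_eq
    omega

/-! The core of the unraveling -/

/-- The copy of an element as a root. -/
def rootNode (J : Interp σ.shred D) (S : Set D) (Φ : Set (FD σ)) (d : D) : J.UnravelDom S Φ :=
  ⟨root d, trivial⟩

/-- Core roots are pairwise linked, and a position of a core tuple whose value lies in `S` is
attached. -/
theorem unravel_rel_core_iff (R : σ.shred.Rel) (a : Fin (σ.shred.arity R) → D)
    (ha : ∀ i, a i ∈ S) :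
    (J.unravel S Φ).rel R (fun i => rootNode J S Φ (a i)) ↔ J.rel R a := by
  refine ⟨fun h => unravel_isHom R _ h, fun h => ?_⟩
  cases R with
  | base R hR => exact ⟨h, fun i j => .inr (.inl ⟨a i, ha i, a j, ha j, rfl, rfl⟩)⟩
  | elt => exact (rel_elt_iff J).1 h
  | tup R hR => exact (rel_tup_iff J).1 h
  | proj R hR i =>
    have h' := (rel_proj_iff J).1 h
    exact ⟨h', .inr ⟨⟨ha (0 : Fin 2), _, ha (1 : Fin 2), ⟨R, hR, i, rfl, h'⟩⟩,
      .inl ⟨_, ha (0 : Fin 2), _, ha (1 : Fin 2), rfl, rfl⟩⟩⟩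

/-- Functional dependencies on the unshredding are reflected by injective homomorphisms. -/
theorem IsHom.satFD_unshred {D' E : Type u} {T : Interp σ.shred E} {I : Interp σ.shred D'}
    {p : E → D'} (hp : T.IsHom I p) (hinj : Function.Injective p) {φ : FD σ}
    (h : I.unshred.SatFD φ) : T.unshred.SatFD φ := by
  have helt : ∀ a : {a // T.elt a}, I.elt (p a.1) := fun a => hp _ _ a.2
  have hrel : ∀ a, T.unshred.rel φ.rel a →
      I.unshred.rel φ.rel (fun i => ⟨p (a i).1, helt (a i)⟩) := by
    rintro a (⟨h, -⟩ | ⟨h, t, ht, ha⟩)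
    · exact absurd φ.higher (not_lt.mpr h)
    · exact .inr ⟨h, p t, hp _ _ ht, fun i => (rel_proj_iff I).1 (hp _ _ (ha i))⟩
  intro a b ha hb hab
  have := h _ _ (hrel a ha) (hrel b hb) fun i hi => Subtype.ext (by rw [hab i hi])
  exact Subtype.ext (hinj (congrArg Subtype.val this))

end Interp

/-! ### The lemma, with the core as the new witness -/

/-- Unraveling in the presence of functional dependencies. A witness of the fact `F` is given by a
match `f`; it is the interpretation induced by the image of the variables of `F`. -/
theorem mainTheorem7 (σ : Signature.{v}) (Φ : Set (FD σ))
    (Θ : Set (C2 σ.low)) (hΘ : ∀ θ ∈ Θ, θ.IsConstraint)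
    (Δ : Set (Rule σ ℕ)) (hΔ : ∀ τ ∈ Δ, τ.FrontierOne ∧ τ.NonConflicting Φ)
    (F q : Conj σ.shred ℕ)
    (D : Type u) [Nonempty D] (J : Interp σ.shred D)
    (f : ℕ → D) (hF : J.IsMatch f F)
    (hWΦ : ∀ φ ∈ Φ, (J.induce (f '' F.vars)).unshred.SatFD φ)
    (hJΘ : ∀ θ ∈ Θ, J.low.SatC2 θ)
    (hJΔ : ∀ τ ∈ Δ, J.SatRule τ.shred)
    (hJwf : J.WellFormed)
    (hJq : ¬ J.SatCQ q) :
    ∃ (E : Type u) (_ : Nonempty E) (T : Interp σ.shred E) (g : ℕ → E) (p : E → D),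
      -- the existential closure of `F` holds, with a witness that satisfies `Φ`
      T.IsMatch g F ∧
      (∀ φ ∈ Φ, (T.induce (g '' F.vars)).unshred.SatFD φ) ∧
      -- the constraints, the rules, well-formedness and the negated query hold
      (∀ θ ∈ Θ, T.low.SatC2 θ) ∧
      (∀ τ ∈ Δ, T.SatRule τ.shred) ∧
      T.WellFormed ∧
      ¬ T.SatCQ q ∧
      -- the result is cycle-free and FD-safe except for the witness
      T.CycleFreeExcept (g '' F.vars) ∧
      T.FDSafeExcept Φ (g '' F.vars) ∧
      -- `p` is a homomorphism to `J` which identifies the new witness with the given one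
      T.IsHom J p ∧
      (∀ x ∈ F.vars, p (g x) = f x) ∧
      Set.InjOn p (g '' F.vars) ∧
      (∀ (R : σ.shred.Rel) (a : Fin (σ.shred.arity R) → E), (∀ i, a i ∈ g '' F.vars) →
        (T.rel R a ↔ J.rel R (fun i => p (a i)))) := by
  have himg : Interp.rootNode J (f '' F.vars) Φ ∘ f '' F.vars =
      {n : J.UnravelDom (f '' F.vars) Φ | ∃ a ∈ f '' F.vars, n.1 = UnravelNode.root a} := by
    ext n
    constructor
    · rintro ⟨x, hx, rfl⟩
      exact ⟨f x, ⟨x, hx, rfl⟩, rfl⟩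
    · rintro ⟨_, ⟨x, hx, rfl⟩, hn⟩
      exact ⟨x, hx, Subtype.ext hn.symm⟩
  have hroot : ∀ n ∈ Interp.rootNode J (f '' F.vars) Φ ∘ f '' F.vars,
      n.1.val ∈ f '' F.vars ∧ n = Interp.rootNode J (f '' F.vars) Φ n.1.val := by
    rintro _ ⟨x, hx, rfl⟩
    exact ⟨⟨x, hx, rfl⟩, rfl⟩
  have hinj : Set.InjOn (fun n : J.UnravelDom (f '' F.vars) Φ => n.1.val)
      (Interp.rootNode J (f '' F.vars) Φ ∘ f '' F.vars) := by
    intro m hm n hn (hmn : m.1.val = n.1.val)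
    rw [(hroot m hm).2, (hroot n hn).2, hmn]
  refine ⟨J.UnravelDom (f '' F.vars) Φ, ⟨Interp.rootNode J _ Φ (Classical.arbitrary D)⟩,
    J.unravel (f '' F.vars) Φ, Interp.rootNode J _ Φ ∘ f, fun n => n.1.val, ?_, ?_,
    fun θ hθ => hJwf.unravel_satC2 (hΘ θ hθ) (hJΘ θ hθ),
    fun τ hτ => hJwf.unravel_satRule (hΔ τ hτ).1 (hΔ τ hτ).2 (hJΔ τ hτ),
    hJwf.unravel, fun ⟨h, hh⟩ => hJq ⟨_, Interp.unravel_isHom.isMatch hh⟩, ?_, ?_,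
    Interp.unravel_isHom, fun _ _ => rfl, hinj, ?_⟩
  · intro A hA
    exact (Interp.unravel_rel_core_iff (S := f '' F.vars) A.rel (fun i => f (A.args i))
      fun i => ⟨A.args i, ⟨A, hA, i, rfl⟩, rfl⟩).2 (hF A hA)
  · intro φ hφ
    -- On the core, `val` is an injective homomorphism to the given witness, so the dependencies
    -- pull back.
    refine Interp.IsHom.satFD_unshred (I := J.induce (f '' F.vars))
      (p := fun n : ↥(Interp.rootNode J (f '' F.vars) Φ ∘ f '' F.vars) =>
        ⟨n.1.1.val, (hroot n.1 n.2).1⟩) (fun R a h => Interp.unravel_isHom R _ h) ?_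
      (hWΦ φ hφ)
    intro m n hmn
    exact Subtype.ext (hinj m.2 n.2 (congrArg Subtype.val hmn))
  · rw [himg]
    exact Interp.unravel_cycleFreeExcept
  · rw [himg]
    exact hJwf.unravel_fdSafeExcept
  · intro R a ha
    have h := Interp.unravel_rel_core_iff (J := J) (Φ := Φ) R (fun i => (a i).1.val) fun i =>
      (hroot _ (ha i)).1
    rwa [← funext fun i => (hroot _ (ha i)).2] at h
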